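/- **Setting.** Let $G$ be a connected undirected graph on a finite set $V$ of $n$ agents with pairwise distinct identifiers in $\mathbb N$; agent $i$ holds an observation $x_i\in\mathbb R^d$ ($d\ge1$). All agents know a common integer $\tilde n\ge n$. Let $k\ge1$ be the number of clusters, $M\ge1$ the maximal number of steps, and $c_1(0),\dots,c_k(0)\in\mathbb R^d$ arbitrary initial centroids. Ties in nearest-centroid choices are broken by an arbitrary rule that selects, for each observation and each iteration, an element of the set of minimizers; both algorithms use the same rule. **Centralized $k$-means.** For $T=0,1,2,\dots$: put $a_i(T)\in\arg\min_j\|x_i-c_j(T)\|^2$, $r_{ij}(T)=1$ if $j=a_i(T)$ and $0$ otherwise, and $c_j(T+1)=\sum_i r_{ij}(T)x_i/\sum_i r_{ij}(T)$. If cluster $j$ is empty, $c_j(T+1)$ is undefined and is treated as infinitely far from every observation. **Consensus procedures.** Let $H$ be an undirected graph on $V$ with neighbourhoods $\mathcal N_i$, and let agent $i$ use the integer $N_i$ as a bound on the number of agents. - *Max-consensus:* agent $i$ returns $z_i(N_i)$, where $z_i(t+1)=\max_{j\in\mathcal N_i\cup\{i\}}z_j(t)$, component-wise, with values $-\infty$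 allowed. - *Finite-time average consensus:* states follow $z_i(t+1)=w_{ii}z_i(t)+\sum_{j\in\mathcal N_i}w_{ij}z_j(t)$ with $w_{ij}=1/N_i$ for $j\in\mathcal N_i$ and $w_{ii}=1-\sum_{j\in\mathcal N_i}w_{ij}$. This is first run from preparatory scalar initial conditions $z_{*,1},z_{*,2},\dots\in\mathbb R^V$, of which the first $n$ are linearly independent and which are otherwise arbitrary (they may differ from call to call). Let $\zeta_i(s)\in\mathbb R^{N_i}$ be the vector of the values of agent $i$ at time $s$ in the runs $1,\dots,N_i$. Agent $i$ finds the least $\delta_i\ge0$ for which $\zeta_i(0),\dots,\zeta_i(\delta_i+1)$ are linearly dependent, a monic polynomial $q_i(g)=\sum_{s\le\delta_i+1}\alpha_{i,s}g^s$ of degree $\delta_i+1$ with $\sum_s\alpha_{i,s}\zeta_i(s)=0$, and $p_i(g)=q_i(g)/(g-1)=\sum_{s\le\delta_i}\beta_{i,s}g^s$. It returns $\sum_{s\le\delta_i}\frac{\beta_{i,s}}{p_i(1)}z_i(s)$, where $z$ is the run from the actual (scalar or vector) initial condition. **Distributed $k$-means** (all agents act synchronously). *Initialization, with bound $\tilde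 n$:* the leader is the agent whose identifier equals the result of max-consensus of the identifiers over $G$; $n_i$ is the reciprocal of the finite-time average consensus over $G$ of the indicator of the leader. Agent $i$ uses $\lfloor n_i\rfloor$ as its bound from now on. The leader sets $c_{ij}=c_j(0)$ for all $j$; the other agents set $c_{ij}=(-\infty,\dots,-\infty)$. *Step $T=1,2,\dots$:* 1. Propagation: max-consensus over $G$ of $c_i^0\in[-\infty,\infty]^{kd}$, where $c_i^0=(c_{ij})_j$ if $T=1$, while for $T>1$ the vector $c_i^0$ has $j$-th block $c_{ij}$ for $j=\bar j_i(T-1)$ and all other blocks $-\infty$. The result is $c_i^{\rm rec}(T)=(c_{ij}^{\rm rec}(T))_j$. 2. Choice: $\bar j_i(T)\in\arg\min_j|c^{\rm rec}_{ij}(T)-x_i|$, the distance being $\infty$ if $c^{\rm rec}_{ij}(T)$ is not finite. Let $\mathcal N_i^c(T)$ be the neighbours of $i$ in $G$ with the same choice, and $G^c(T)$ the subgraph of $G$ with these neighbourhoods. 3. Sub-clusters: over $G^c(T)$, $SCC_i$ is the finite-time average consensus of the $x_j$; $i$ is a sub-cluster leader if the max-consensus of the identifiers returns its own; $SCS_i$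 is the reciprocal of the finite-time average consensus of the indicator of the sub-cluster leaders. 4. Centroids: finite-time average consensus over $G$ of the vectors $\eta_i^0\in(\mathbb R^{d}\times\mathbb R)^k$ whose block $\bar j_i(T)$ is $(SCS_i\,SCC_i,\,SCS_i)$ if $i$ is a sub-cluster leader, all other blocks (and all blocks of non-leaders) being $0$. If block $j$ of the result at agent $i$ is $(\bar\sigma_j,\bar\epsilon_j)$, then $c_{ij}(T)=\bar\sigma_j/\bar\epsilon_j$, with the value $(-\infty,\dots,-\infty)$, meaning undefined, if $\bar\epsilon_j=0$. 5. Exit test of agent $i$. Method $C_1$: exit if the max-consensus over $G$ of the indicators of $\bar j_i(T)\ne\bar j_i(T-1)$ is $0$, where $\bar j_i(0)$ is not a cluster index. Method $C_2$: let $\bar\nu_i(T)$ be the finite-time average consensus over $G$ of $n_i\|c_{i\bar j_i(T)}(T)-x_i\|^2$; for $T\ge2$ exit if $\bar\nu_i(T)-\bar\nu_i(T-1)<\Delta_{\max}$ (or, in a variant, if $|\bar\nu_i(T)-\bar\nu_i(T-1)|<\Delta_{\max}$). An agent stops, and returns $c_{i1}(T),\dots,c_{ik}(T)$, $\bar j_i(T)$,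 $\mathcal N_i^c(T)$, after the first step $T$ with $T\ge M$ or with its exit test satisfied. Centralized $k$-means stops by the same rule: step $T\ge1$ is its iteration $T-1$. Under $C_1$ it exits if $T\ge2$ and $a(T-1)=a(T-2)$. Under $C_2$ it exits if $T\ge2$ and $D_T-D_{T-1}<\Delta_{\max}$ (respectively $|D_T-D_{T-1}|<\Delta_{\max}$), where $D_T=\sum_{i,j}r_{ij}(T-1)\|x_i-c_j(T)\|^2$. **Theorem.** For every step $T\ge1$ and every agent $i$ (steps being continued formally past the stopping time): - $c^{\rm rec}_{ij}(T)=c_j(T-1)$, $\ \bar j_i(T)=a_i(T-1)$ and $c_{ij}(T)=c_j(T)$ for all $j$, where an undefined centroid is represented by $(-\infty,\dots,-\infty)$; - the objective has the same value for both algorithms, before and after refinement of the centroids: $\sum_i\|x_i-c^{\rm rec}_{i\bar j_i(T)}(T)\|^2=\sum_{i,j}r_{ij}(T-1)\|x_i-c_j(T-1)\|^2$ and $\sum_i\|x_i-c_{i\bar j_i(T)}(T)\|^2=\sum_{i,j}r_{ij}(T-1)\|x_i-c_j(T)\|^2$ (undefined centroids, to which no observation is assigned, contribute $0$); - the exit test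 of agent $i$ is satisfied at step $T$ if and only if that of centralized $k$-means is. Consequently all agents stop at the same step $T^*$ as centralized $k$-means, and agent $i$ returns the centroids $c_1(T^*),\dots,c_k(T^*)$, its assignment $a_i(T^*-1)$, and the set of its neighbours in $G$ with the same assignment. -/

import Mathlib

namespace DistKMeans

noncomputable section

open Classical in
/-- Neighbourhood of agent `i` in the communication graph `H`. -/
def nbhd {V : Type*} [Fintype V] (H : SimpleGraph V) (i : V) : Finset V :=
  Finset.univ.filter fun j => H.Adj i j

/-! ### Max-consensus -/

open Classical in
/-- One synchronous round of max-consensus: every agent takes the (component-wise) maximum over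
its neighbourhood and itself. -/
def maxRound {V α : Type*} [Fintype V] [SemilatticeSup α] (H : SimpleGraph V) (z : V → α) :
    V → α :=
  fun i => (insert i (nbhd H i)).sup' (Finset.insert_nonempty _ _) z

/-- `maxConsensus H N z₀ i` is the state of agent `i` after the `N i` rounds it executes. -/
def maxConsensus {V α : Type*} [Fintype V] [SemilatticeSup α] (H : SimpleGraph V) (N : V → ℕ)
    (z₀ : V → α) (i : V) : α :=
  ((maxRound H)^[N i] z₀) i

/-! ### Finite-time average-consensus -/

/-- Weight `1 / N i` given by agent `i` to each of its neighbours. -/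
def nbrWeight {V : Type*} (N : V → ℕ) (i : V) : ℝ := 1 / (N i : ℝ)

/-- One synchronous round of the linear iteration `z_i(t+1) = w_ii z_i(t) + ∑_{j ∈ N_i} w_ij z_j(t)`
with `w_ij = 1 / N i` for neighbours `j` of `i`, and `w_ii = 1 - ∑_{l ∈ N_i} w_il`. -/
def avgRound {V E : Type*} [Fintype V] [AddCommGroup E] [Module ℝ E] (H : SimpleGraph V)
    (N : V → ℕ) (z : V → E) : V → E :=
  fun i => (1 - ∑ _l ∈ nbhd H i, nbrWeight N i) • z i + ∑ j ∈ nbhd H i, nbrWeight N i • z j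

/-- State at time `t` of the linear iteration started from `z₀`. -/
def avgIter {V E : Type*} [Fintype V] [AddCommGroup E] [Module ℝ E] (H : SimpleGraph V)
    (N : V → ℕ) (z₀ : V → E) (t : ℕ) : V → E :=
  (avgRound H N)^[t] z₀

/-- The column, indexed by the preparatory runs `j = 0, …, N i - 1`, of the values that agent `i`
observes at time `s`; run `j` starts from `prep j`. -/
def prepColumn {V : Type*} [Fintype V] (H : SimpleGraph V) (N : V → ℕ) (prep : ℕ → V → ℝ)
    (i : V) (s : ℕ) : Fin (N i) → ℝ :=
  fun j => avgIter H N (prep j) s i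

/-- The least `δ` such that the observed columns at times `0, …, δ + 1` are linearly dependent. -/
def degIndex {V : Type*} [Fintype V] (H : SimpleGraph V) (N : V → ℕ) (prep : ℕ → V → ℝ)
    (i : V) : ℕ :=
  sInf {δ : ℕ | ¬ LinearIndependent ℝ fun s : Fin (δ + 2) => prepColumn H N prep i s}

/-- The polynomial `q_i` computed by agent `i`: monic of degree `δ_i + 1`, with coefficients in the
null space of the matrix of observed columns. -/
def agentPoly {V : Type*} [Fintype V] (H : SimpleGraph V) (N : V → ℕ) (prep : ℕ → V → ℝ)
    (i : V) : Polynomial ℝ :=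
  Classical.epsilon fun q : Polynomial ℝ =>
    q.Monic ∧ q.natDegree = degIndex H N prep i + 1 ∧
      ∑ s ∈ Finset.range (degIndex H N prep i + 2), q.coeff s • prepColumn H N prep i s = 0

/-- `p_i(g) = q_i(g) / (g - 1)`. -/
def agentQuot {V : Type*} [Fintype V] (H : SimpleGraph V) (N : V → ℕ) (prep : ℕ → V → ℝ)
    (i : V) : Polynomial ℝ :=
  agentPoly H N prep i /ₘ (Polynomial.X - Polynomial.C 1)

/-- Value returned to agent `i` by the finite-time average-consensus procedure on `H` with bounds
`N`, preparatory initial conditions `prep` and initial states `z₀`: the combination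
`∑_{s ≤ δ_i} γ_{i,s} z_i(s)` with `γ_{i,s} = β_{i,s} / p_i(1)`, where the `β_{i,s}` are the
coefficients of `p_i`. -/
def ftaConsensus {V E : Type*} [Fintype V] [AddCommGroup E] [Module ℝ E] (H : SimpleGraph V)
    (N : V → ℕ) (prep : ℕ → V → ℝ) (z₀ : V → E) (i : V) : E :=
  ∑ s ∈ Finset.range (degIndex H N prep i + 1),
    ((agentQuot H N prep i).coeff s / (agentQuot H N prep i).eval 1) • avgIter H N z₀ s i

/-! ### Data of a run -/

/-- Exit methods: no change of the assignments; small difference (signed, or in absolute value) of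
two successive values of the objective. -/
inductive ExitRule where
  | assignments : ExitRule
  | objective (Δ : ℝ) : ExitRule
  | objectiveAbs (Δ : ℝ) : ExitRule

/-- The places at which finite-time average-consensus is executed (`T` is the step number). -/
inductive FTACall where
  | networkSize : FTACall
  | subCentroid (T : ℕ) : FTACall
  | subSize (T : ℕ) : FTACall
  | centroid (T : ℕ) : FTACall
  | exitValue (T : ℕ) : FTACall

/-- Data of a run with agents `V`, observations in `ℝ^d` and `k` clusters. -/
structure Data (V : Type*) (d k : ℕ) where
  /-- communication graph (undirected) -/
  graph : SimpleGraph V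
  /-- identifiers of the agents -/
  uid : V → ℕ
  /-- known upper bound on the number of agents -/
  nBound : ℕ
  /-- observations -/
  x : V → EuclideanSpace ℝ (Fin d)
  /-- initial centroids (selected by the leader in the distributed algorithm) -/
  cInit : Fin k → EuclideanSpace ℝ (Fin d)
  /-- initial conditions of the preparatory runs in each finite-time average-consensus -/
  prep : FTACall → ℕ → V → ℝ
  /-- choice, at step `T` and for observation `i`, of an element of the set of nearest centroids -/
  tie : ℕ → V → Finset (Fin k) → Fin k
  /-- exit method -/
  rule : ExitRule
  /-- maximal number of iterations -/
  M : ℕ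

/-- Number of executed steps of a loop whose exit flag after step `T = 1, 2, …` is `e T`, and that
executes at most `M` steps. -/
def stopStep (M : ℕ) (e : ℕ → Prop) : ℕ := sInf {T : ℕ | 1 ≤ T ∧ (M ≤ T ∨ e T)}

open Classical in
/-- Set of minimizers of `f`. -/
def argminSet {k : ℕ} (f : Fin k → EReal) : Finset (Fin k) :=
  Finset.univ.filter fun j => ∀ j', f j ≤ f j'

/-- Assignment variable `r_ij` attached to the cluster index `a` of observation `i`. -/
def r {k : ℕ} (a j : Fin k) : ℝ := if a = j then 1 else 0

/-! ### Centralized `k`-means -/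

/-- Squared distance to a centroid; a centroid which is undefined, because its cluster was empty, is
infinitely far. -/
def sqDist {d : ℕ} (y : EuclideanSpace ℝ (Fin d)) : Option (EuclideanSpace ℝ (Fin d)) → EReal
  | none => ⊤
  | some c => ((‖y - c‖ ^ 2 : ℝ) : EReal)

/-- Refinement: the mean of the observations of each cluster, `none` for an empty cluster (for which
the quotient is undefined). -/
def refine {V : Type*} [Fintype V] {d k : ℕ} (x : V → EuclideanSpace ℝ (Fin d)) (a : V → Fin k) :
    Fin k → Option (EuclideanSpace ℝ (Fin d)) :=
  fun j => if ∑ i, r (a i) j = 0 then none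
    else some ((∑ i, r (a i) j)⁻¹ • ∑ i, r (a i) j • x i)

/-- Objective `D = ∑_i ∑_j r_ij ‖x_i - c_j‖²`. -/
def objective {V : Type*} [Fintype V] {d k : ℕ} (x : V → EuclideanSpace ℝ (Fin d))
    (c : Fin k → Option (EuclideanSpace ℝ (Fin d))) (a : V → Fin k) : ℝ :=
  ∑ i, ∑ j, r (a i) j * (sqDist (x i) (c j)).toReal

namespace Data

variable {V : Type*} [Fintype V] {d k : ℕ}

/-- Assignment phase: `T` is the index of the iteration, `c` the current centroids. -/
def assign (P : Data V d k) (T : ℕ) (c : Fin k → Option (EuclideanSpace ℝ (Fin d))) : V → Fin k :=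
  fun i => P.tie T i (argminSet fun j => sqDist (P.x i) (c j))

/-- Centroids `c(T)` of centralized `k`-means. -/
def kCentroid (P : Data V d k) : ℕ → Fin k → Option (EuclideanSpace ℝ (Fin d))
  | 0 => fun j => some (P.cInit j)
  | T + 1 => refine P.x (P.assign T (P.kCentroid T))

/-- Assignment at iteration `T` of centralized `k`-means, computed from `c(T)`. -/
def kAssign (P : Data V d k) (T : ℕ) : V → Fin k := P.assign T (P.kCentroid T)

/-- Objective at the end of iteration `T`, i.e. for the assignment `r(T)` and the centroids
`c(T+1)` of its clusters. -/
def kObjective (P : Data V d k) (T : ℕ) : ℝ := objective P.x (P.kCentroid (T + 1)) (P.kAssign T)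

/-- Exit flag of centralized `k`-means after `T` executed iterations (with indices `0, …, T - 1`);
there is nothing to compare with before the second one. -/
def kExit (P : Data V d k) : ℕ → Prop
  | 0 => False
  | 1 => False
  | T + 2 =>
    match P.rule with
    | .assignments => P.kAssign (T + 1) = P.kAssign T
    | .objective Δ => P.kObjective (T + 1) - P.kObjective T < Δ
    | .objectiveAbs Δ => |P.kObjective (T + 1) - P.kObjective T| < Δ

/-- Number of iterations executed by centralized `k`-means. -/
def kStop (P : Data V d k) : ℕ := stopStep P.M P.kExit

end Data

/-! ### Distributed `k`-means -/

/-- Real vectors as extended real vectors. -/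
def toExt {d : ℕ} (v : EuclideanSpace ℝ (Fin d)) : Fin d → EReal := fun l => ((v l : ℝ) : EReal)

/-- Extended real vector of a possibly undefined centroid; undefined is `(-∞, …, -∞)`. -/
def optToExt {d : ℕ} : Option (EuclideanSpace ℝ (Fin d)) → Fin d → EReal
  | none => fun _ => ⊥
  | some v => toExt v

/-- Real vector with the same finite components. -/
def ofExt {d : ℕ} (c : Fin d → EReal) : EuclideanSpace ℝ (Fin d) :=
  WithLp.toLp 2 fun l => (c l).toReal

open Classical in
/-- `|c - y|` for an extended real vector `c`; infinite when a component of `c` is. -/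
def extDist {d : ℕ} (c : Fin d → EReal) (y : EuclideanSpace ℝ (Fin d)) : EReal :=
  if ∀ l, c l ≠ ⊥ ∧ c l ≠ ⊤ then ((‖ofExt c - y‖ : ℝ) : EReal) else ⊤

/-- The variables of all agents at the end of a step of the distributed algorithm. -/
structure DState (V : Type*) (d k : ℕ) where
  /-- centroids known to each agent after the centroid propagation phase -/
  received : V → Fin k → Fin d → EReal
  /-- index of the chosen centroid (`none` before the first step) -/
  choice : V → Option (Fin k)
  /-- neighbours with the same choice -/
  cnbhd : V → Finset V
  /-- centroids known to each agent after the centroid calculation phase -/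
  centroid : V → Fin k → Fin d → EReal
  /-- value on which the exit condition is evaluated (`none` before the first step) -/
  nu : V → Option ℝ
  /-- exit flag of each agent -/
  exit : V → Prop

/-- `μ_i`: one at the chosen index, zero elsewhere. -/
def mu {k : ℕ} (a : Fin k) : Fin k → EReal := fun j => if j = a then 1 else 0

/-- `μ̂_i`: zero at the chosen index, `-∞` elsewhere. -/
def muHat {k : ℕ} (a : Fin k) : Fin k → EReal := fun j => if j = a then 0 else ⊥

/-- `μ ⊗ c + μ̂ ⊗ 1_d`. -/
def propInit {d k : ℕ} (a : Fin k) (c : Fin d → EReal) : Fin k → Fin d → EReal :=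
  fun j l => mu a j * c l + muHat a j

open Classical in
/-- `σ / ε`; this is undefined, i.e. `(-∞, …, -∞)`, if `ε = 0`. -/
def extQuot {d : ℕ} (σε : EuclideanSpace ℝ (Fin d) × ℝ) : Fin d → EReal :=
  if σε.2 = 0 then fun _ => ⊥ else toExt (σε.2⁻¹ • σε.1)

/-- The subgraph of `G` in which each agent is connected to its neighbours with the same choice. -/
def clusterGraph {V : Type*} {k : ℕ} (G : SimpleGraph V) (a : V → Fin k) : SimpleGraph V where
  Adj i j := G.Adj i j ∧ a i = a j
  symm := ⟨fun _ _ h => ⟨h.1.symm, h.2.symm⟩⟩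
  loopless := ⟨fun _ h => h.1.ne rfl⟩

namespace Data

variable {V : Type*} [Fintype V] {d k : ℕ}

/-- Leader election: agent `i` is the leader. -/
def isLeader (P : Data V d k) (i : V) : Prop :=
  maxConsensus P.graph (fun _ => P.nBound) P.uid i = P.uid i

open Classical in
/-- Network size calculation: the value `n_i` computed by agent `i`. -/
def size (P : Data V d k) (i : V) : ℝ :=
  1 / ftaConsensus P.graph (fun _ => P.nBound) (P.prep .networkSize)
    (fun j => if P.isLeader j then (1 : ℝ) else 0) i

/-- `n_i` as the integer with which agent `i` runs the consensus procedures of the main cycle. -/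
def sizeNat (P : Data V d k) (i : V) : ℕ := ⌊P.size i⌋₊

open Classical in
/-- State of the agents after the initialization. -/
def dInit (P : Data V d k) : DState V d k where
  received := fun _ _ _ => ⊥
  choice := fun _ => none
  cnbhd := fun i => nbhd P.graph i
  centroid := fun i j => if P.isLeader i then toExt (P.cInit j) else fun _ => ⊥
  nu := fun _ => none
  exit := fun _ => False

/-- Centroid propagation. -/
def dReceived (P : Data V d k) (s : DState V d k) : V → Fin k → Fin d → EReal :=
  maxConsensus P.graph P.sizeNat fun i =>
    match s.choice i with
    | none => s.centroid i
    | some a => propInit a (s.centroid i a)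

/-- Nearest centroid choice at step `T + 1`, after receiving the centroids `c`. -/
def dChoice (P : Data V d k) (T : ℕ) (c : V → Fin k → Fin d → EReal) : V → Fin k :=
  fun i => P.tie T i (argminSet fun j => extDist (c i j) (P.x i))

/-- Sub-cluster centroid identification: the value `SCC_i`. -/
def scc (P : Data V d k) (T : ℕ) (a : V → Fin k) : V → EuclideanSpace ℝ (Fin d) :=
  ftaConsensus (clusterGraph P.graph a) P.sizeNat (P.prep (.subCentroid T)) P.x

/-- Sub-cluster leader election: agent `i` is the leader of its sub-cluster. -/
def isSubLeader (P : Data V d k) (a : V → Fin k) (i : V) : Prop :=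
  maxConsensus (clusterGraph P.graph a) P.sizeNat P.uid i = P.uid i

open Classical in
/-- Sub-cluster size calculation: the value `SCS_i`. -/
def scs (P : Data V d k) (T : ℕ) (a : V → Fin k) (i : V) : ℝ :=
  1 / ftaConsensus (clusterGraph P.graph a) P.sizeNat (P.prep (.subSize T))
    (fun j => if P.isSubLeader a j then (1 : ℝ) else 0) i

open Classical in
/-- Initial condition `η_i⁰ = e_a ⊗ (σ_i, ε_i)`, `a` being the choice of agent `i`. -/
def etaInit (P : Data V d k) (T : ℕ) (a : V → Fin k) (i : V) :
    Fin k → EuclideanSpace ℝ (Fin d) × ℝ :=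
  Pi.single (a i)
    (if P.isSubLeader a i then (P.scs T a i • P.scc T a i, P.scs T a i) else (0, 0))

/-- Centroid calculation. -/
def dCentroid (P : Data V d k) (T : ℕ) (a : V → Fin k) : V → Fin k → Fin d → EReal :=
  fun i j => extQuot (ftaConsensus P.graph P.sizeNat (P.prep (.centroid T)) (P.etaInit T a) i j)

open Classical in
/-- The value `ν̄_i` for the previous choices `a'`, the choices `a` and the new centroids `c`. -/
def dNu (P : Data V d k) (T : ℕ) (a' : V → Option (Fin k)) (a : V → Fin k)
    (c : V → Fin k → Fin d → EReal) (i : V) : ℝ :=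
  match P.rule with
  | .assignments =>
    maxConsensus P.graph P.sizeNat (fun j => if a' j = some (a j) then (0 : ℝ) else 1) i
  | _ =>
    ftaConsensus P.graph P.sizeNat (P.prep (.exitValue T))
      (fun j => P.size j * ‖ofExt (c j (a j)) - P.x j‖ ^ 2) i

/-- Exit condition, from the previous value of `ν̄_i` (if any) and the present one. -/
def dExit (P : Data V d k) (prev : Option ℝ) (ν : ℝ) : Prop :=
  match P.rule with
  | .assignments => ν = 0
  | .objective Δ => ∃ ν', prev = some ν' ∧ ν - ν' < Δ
  | .objectiveAbs Δ => ∃ ν', prev = some ν' ∧ |ν - ν'| < Δ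

open Classical in
/-- Step `T + 1` of the main cycle, executed synchronously by all agents. -/
def dStep (P : Data V d k) (T : ℕ) (s : DState V d k) : DState V d k :=
  let c := P.dReceived s
  let a := P.dChoice T c
  let c' := P.dCentroid (T + 1) a
  let ν := P.dNu (T + 1) s.choice a c'
  { received := c
    choice := fun i => some (a i)
    cnbhd := fun i => (nbhd P.graph i).filter fun j => a j = a i
    centroid := c'
    nu := fun i => some (ν i)
    exit := fun i => P.dExit (s.nu i) (ν i) }

/-- Variables of the agents at the end of step `T` of the main cycle (`T = 0`: after the
initialization). -/
def dState (P : Data V d k) : ℕ → DState V d k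
  | 0 => P.dInit
  | T + 1 => P.dStep T (P.dState T)

/-- Number of steps executed by agent `i`, according to its own exit flag. -/
def dStop (P : Data V d k) (i : V) : ℕ := stopStep P.M fun T => (P.dState T).exit i

end Data

open Classical in
/-- Objective `∑_i ∑_j r_ij ‖x_i - c_ij‖²` for the choices and the centroids held by the agents. -/
def dObjective {V : Type*} [Fintype V] {d k : ℕ} (x : V → EuclideanSpace ℝ (Fin d))
    (c : V → Fin k → Fin d → EReal) (choice : V → Option (Fin k)) : ℝ :=
  ∑ i, ∑ j, (if choice i = some j then (1 : ℝ) else 0) * ‖x i - ofExt (c i j)‖ ^ 2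

end

end DistKMeans

/-!
After at least `card V` rounds, max-consensus gives each agent the maximum over its component.

With a common bound `m`, the averaging iteration has the symmetric matrix `W = 1 - L / m`, where `L`
is the Laplacian, and its fixed vectors are the functions that are constant on components. An agent
`i` finds the monic polynomial `q` of least degree with `e_i q(W) = 0`. Since `W 1 = 1`, the number
`1` is a root of `q`. For `p = q / (g - 1)` the vector `u = e_i p(W)` is fixed by `W`, and
`⟨u, w⟩ = p(1) ⟨e_i, w⟩` for every fixed `w`. Hence `p(1) = 0` would give `⟨u, u⟩ = 0`, against the
minimality of `q`. As `u` is constant on components, the returned value `⟨u, z⟩ / p(1)` does not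
change if `z` is replaced by its means over the components, and these are fixed by the iteration. So
each agent obtains the mean over its component.

The sub-clusters are the components of the graph of equal choices and each has exactly one leader.
A leader contributes the sum and the number of the observations of its sub-cluster, so the quotient
of the two averages over the network is the centroid of the cluster.
-/

namespace DistKMeans

open Finset Polynomial
open scoped Matrix

section Component

variable {V : Type*} [Fintype V] {H : SimpleGraph V} {i j : V}

lemma mem_nbhd : j ∈ nbhd H i ↔ H.Adj i j := by
  simp [nbhd]

open scoped Classical in
/-- The vertex set of the connected component of `i`, as a `Finset` so that one can sum over it. -/
noncomputable def component (H : SimpleGraph V) (i : V) : Finset V :=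
  univ.filter (H.Reachable i)

lemma mem_component : j ∈ component H i ↔ H.Reachable i j := by
  simp [component]

lemma component_eq_of_reachable (h : H.Reachable i j) : component H i = component H j := by
  ext l
  simpa only [mem_component] using ⟨h.symm.trans, h.trans⟩

lemma component_eq_univ (hH : H.Preconnected) (i : V) : component H i = univ := by
  ext j
  simp [mem_component, hH i j]

lemma card_component_ne_zero (H : SimpleGraph V) (i : V) : (#(component H i) : ℝ) ≠ 0 :=
  Nat.cast_ne_zero.2 (card_ne_zero_of_mem (mem_component.2 (SimpleGraph.Reachable.refl i)))

/-- The mean of `z` over the connected component of `i`: the value that average consensus on `H`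
is meant to return to agent `i`. -/
noncomputable def componentMean {E : Type*} [AddCommGroup E] [Module ℝ E] (H : SimpleGraph V)
    (z : V → E) (i : V) : E :=
  (#(component H i) : ℝ)⁻¹ • ∑ j ∈ component H i, z j

lemma componentMean_of_preconnected {E : Type*} [AddCommGroup E] [Module ℝ E]
    (hH : H.Preconnected) (z : V → E) (i : V) :
    componentMean H z i = (Fintype.card V : ℝ)⁻¹ • ∑ j, z j := by
  rw [componentMean, component_eq_univ hH, card_univ]

lemma componentMean_eq_of_reachable {E : Type*} [AddCommGroup E] [Module ℝ E]
    (h : H.Reachable i j) (z : V → E) : componentMean H z i = componentMean H z j := by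
  simp only [componentMean, component_eq_of_reachable h]

lemma sum_smul_componentMean {E : Type*} [AddCommGroup E] [Module ℝ E] {u : V → ℝ}
    (hu : ∀ i j, H.Reachable i j → u i = u j) (z : V → E) :
    ∑ j, u j • componentMean H z j = ∑ l, u l • z l := by
  simp only [componentMean, smul_sum]
  rw [sum_comm' (t' := univ) (s' := component H)
    fun _ _ => by simp [mem_component, SimpleGraph.reachable_comm]]
  refine sum_congr rfl fun l _ => ?_
  calc ∑ j ∈ component H l, u j • (#(component H j) : ℝ)⁻¹ • z l
      = ∑ _j ∈ component H l, u l • (#(component H l) : ℝ)⁻¹ • z l :=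
        sum_congr rfl fun j hj => by
          have hlj := mem_component.1 hj
          rw [component_eq_of_reachable hlj, hu l j hlj]
    _ = u l • z l := by
        rw [sum_const, smul_comm, ← Nat.cast_smul_eq_nsmul ℝ,
          smul_inv_smul₀ (card_component_ne_zero H l)]

lemma card_smul_componentMean {E : Type*} [AddCommGroup E] [Module ℝ E] (z : V → E) (i : V) :
    (#(component H i) : ℝ) • componentMean H z i = ∑ j ∈ component H i, z j :=
  smul_inv_smul₀ (card_component_ne_zero H i) _

/-- The vertices satisfying `L` form a system of representatives of the connected components; this
is what a leader election has to achieve. -/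
def IsTransversal (H : SimpleGraph V) (L : V → Prop) : Prop :=
  ∀ i, ∃! l, H.Reachable i l ∧ L l

namespace IsTransversal

variable {L : V → Prop} [DecidablePred L] (hL : IsTransversal H L)

include hL

lemma componentMean_indicator (i : V) :
    componentMean H (fun l => if L l then (1 : ℝ) else 0) i = (#(component H i) : ℝ)⁻¹ := by
  obtain ⟨l, ⟨hil, hl⟩, hunique⟩ := hL i
  have hsum : ∑ m ∈ component H i, (if L m then (1 : ℝ) else 0) = 1 := by
    rw [sum_eq_single_of_mem l (mem_component.2 hil), if_pos hl]
    exact fun m hm hne => if_neg fun hLm => hne (hunique m ⟨mem_component.1 hm, hLm⟩)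
  rw [componentMean, hsum, smul_eq_mul, mul_one]

lemma sum_sum_component {E : Type*} [AddCommMonoid E] (f : V → E) :
    ∑ i, (if L i then ∑ l ∈ component H i, f l else 0) = ∑ l, f l := by
  classical
  have hfilter : ∀ i, (if L i then ∑ l ∈ component H i, f l else 0) =
      ∑ l, if H.Reachable l i ∧ L i then f l else 0 := by
    intro i
    by_cases hi : L i
    · simp only [component, hi, if_true, and_true, sum_filter, SimpleGraph.reachable_comm]
    · simp only [hi, if_false, and_false, sum_const_zero]
  rw [sum_congr rfl fun i _ => hfilter i, sum_comm]
  refine sum_congr rfl fun l _ => ?_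
  obtain ⟨m, hm, hunique⟩ := hL l
  rw [sum_eq_single_of_mem m (mem_univ m) fun i _ hne => if_neg fun hi => hne (hunique i hi),
    if_pos hm]

end IsTransversal

end Component

section MaxConsensus

variable {V : Type*} [Fintype V] {H : SimpleGraph V} {N : V → ℕ} {i : V}

section SemilatticeSup

variable {α : Type*} [SemilatticeSup α] {z : V → α} {u : α}

lemma maxRound_le_iff : maxRound H z i ≤ u ↔ z i ≤ u ∧ ∀ j, H.Adj i j → z j ≤ u := by
  simp only [maxRound, sup'_le_iff, mem_insert, forall_eq_or_imp, mem_nbhd]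

lemma iterate_maxRound_le_iff {t : ℕ} :
    (maxRound H)^[t] z i ≤ u ↔ ∀ j (p : H.Walk i j), p.length ≤ t → z j ≤ u := by
  induction t generalizing i with
  | zero =>
    refine ⟨fun h j p hp => ?_, fun h => h i .nil le_rfl⟩
    rwa [← p.eq_of_length_eq_zero (Nat.le_zero.1 hp)]
  | succ t ih =>
    rw [Function.iterate_succ_apply', maxRound_le_iff]
    simp only [ih]
    constructor
    · rintro ⟨hself, hadj⟩ j (_ | ⟨hil, q⟩) hp
      · exact hself i .nil (Nat.zero_le t)
      · exact hadj _ hil j q (Nat.succ_le_succ_iff.1 hp)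
    · exact fun h => ⟨fun j p hp => h j p (hp.trans t.le_succ),
        fun l hil j p hp => h j (.cons hil p) (Nat.succ_le_succ hp)⟩

lemma maxConsensus_le_iff (hN : Fintype.card V ≤ N i) :
    maxConsensus H N z i ≤ u ↔ ∀ j, H.Reachable i j → z j ≤ u := by
  rw [maxConsensus, iterate_maxRound_le_iff]
  refine ⟨fun h j hij => ?_, fun h j p _ => h j p.reachable⟩
  obtain ⟨p, hp⟩ := hij.exists_isPath
  exact h j p (hp.length_lt.le.trans hN)

lemma le_maxConsensus {j : V} (hN : Fintype.card V ≤ N i) (hij : H.Reachable i j) :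
    z j ≤ maxConsensus H N z i :=
  (maxConsensus_le_iff hN).1 le_rfl j hij

lemma maxConsensus_eq_of_attained {β : Type*} [OrderBot α] (hH : H.Preconnected)
    (hN : Fintype.card V ≤ N i) {z : V → β → α} {u : β → α} (hle : ∀ j, z j ≤ u)
    (hatt : ∀ b, u b = ⊥ ∨ ∃ j, z j b = u b) : maxConsensus H N z i = u := by
  refine le_antisymm ((maxConsensus_le_iff hN).2 fun j _ => hle j) fun b => ?_
  rcases hatt b with hbot | ⟨j, hj⟩
  · exact hbot.trans_le bot_le
  · have hmax : z j ≤ maxConsensus H N z i := le_maxConsensus hN (hH i j)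
    exact hj.ge.trans (hmax b)

end SemilatticeSup

lemma maxConsensus_indicator_eq_zero_iff (hH : H.Preconnected) (hN : Fintype.card V ≤ N i)
    {p : V → Prop} [DecidablePred p] :
    maxConsensus H N (fun j => if p j then (0 : ℝ) else 1) i = 0 ↔ ∀ j, p j := by
  have hnonneg : 0 ≤ maxConsensus H N (fun j => if p j then (0 : ℝ) else 1) i :=
    le_trans (by split_ifs <;> norm_num) (le_maxConsensus hN (SimpleGraph.Reachable.refl i))
  have hindicator (j : V) : (if p j then (0 : ℝ) else 1) ≤ 0 ↔ p j := by
    by_cases hj : p j <;> simp [hj]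
  rw [← hnonneg.ge_iff_eq', maxConsensus_le_iff hN]
  simp only [hindicator, hH i _, true_imp_iff]

lemma isTransversal_leader {α : Type*} [LinearOrder α] {uid : V → α}
    (huid : Function.Injective uid) (hN : ∀ i, Fintype.card V ≤ N i) :
    IsTransversal H fun l => maxConsensus H N uid l = uid l := by
  intro i
  obtain ⟨l, hl, hmax⟩ := exists_max_image (component H i) uid
    ⟨i, mem_component.2 (SimpleGraph.Reachable.refl i)⟩
  rw [mem_component] at hl
  have hresult (j : V) (hij : H.Reachable i j) : maxConsensus H N uid j = uid l :=
    le_antisymm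
      ((maxConsensus_le_iff (hN j)).2 fun m hjm => hmax m (mem_component.2 (hij.trans hjm)))
      (le_maxConsensus (hN j) (hij.symm.trans hl))
  exact ⟨l, ⟨hl, hresult l hl⟩, fun m hm => huid (hm.2.symm.trans (hresult m hm.1))⟩

end MaxConsensus

section MinimalAnnihilator

variable {ι K : Type*} [Fintype ι] [DecidableEq ι]

section CommRing

variable [CommRing K] {A : Matrix ι ι K} {v w : ι → K} {μ : K} {q : K[X]}

lemma aeval_mulVec_of_mulVec_eq_smul (h : A *ᵥ w = μ • w) (p : K[X]) :
    aeval A p *ᵥ w = p.eval μ • w := by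
  have hlin := Module.End.aeval_apply_of_mem_apply_eq_smul (f := Matrix.toLinAlgEquiv' A) (p := p) h
  rwa [aeval_algHom_apply] at hlin

lemma vecMul_aeval_dotProduct (h : A *ᵥ w = μ • w) (v : ι → K) (p : K[X]) :
    (v ᵥ* aeval A p) ⬝ᵥ w = p.eval μ * (v ⬝ᵥ w) := by
  rw [← Matrix.dotProduct_mulVec, aeval_mulVec_of_mulVec_eq_smul h, dotProduct_smul, smul_eq_mul]

lemma isRoot_of_vecMul_aeval_eq_zero [NoZeroDivisors K] (hq : v ᵥ* aeval A q = 0)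
    (hw : A *ᵥ w = μ • w) (hvw : v ⬝ᵥ w ≠ 0) : q.IsRoot μ := by
  have h := vecMul_aeval_dotProduct hw v q
  rw [hq, zero_dotProduct] at h
  exact (mul_eq_zero.1 h.symm).resolve_right hvw

lemma vecMul_aeval_divByMonic_vecMul (hq : v ᵥ* aeval A q = 0) (hμ : q.IsRoot μ) :
    (v ᵥ* aeval A (q /ₘ (X - C μ))) ᵥ* A = μ • (v ᵥ* aeval A (q /ₘ (X - C μ))) := by
  rw [← mul_divByMonic_eq_iff_isRoot.2 hμ, mul_comm, map_mul, ← Matrix.vecMul_vecMul, map_sub,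
    aeval_X, aeval_C, Matrix.vecMul_sub, Algebra.algebraMap_eq_smul_one, Matrix.vecMul_smul,
    Matrix.vecMul_one, sub_eq_zero] at hq
  exact hq

/-- `q` is the minimal polynomial of the pair `(v, A)`: the monic polynomial of least degree that
annihilates the row vector `v` under the right action of `A`. -/
structure IsMinimalAnnihilator (v : ι → K) (A : Matrix ι ι K) (q : K[X]) : Prop where
  monic : q.Monic
  vecMul_aeval : v ᵥ* aeval A q = 0
  natDegree_le : ∀ p : K[X], p ≠ 0 → v ᵥ* aeval A p = 0 → q.natDegree ≤ p.natDegree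

end CommRing

lemma IsMinimalAnnihilator.eval_divByMonic_ne_zero [Field K] [LinearOrder K] [IsStrictOrderedRing K]
    {A : Matrix ι ι K} {v : ι → K} {μ : K} {q : K[X]} (hq : IsMinimalAnnihilator v A q)
    (hA : A.IsSymm) (hμ : q.IsRoot μ) : (q /ₘ (X - C μ)).eval μ ≠ 0 := by
  intro heval
  set p := q /ₘ (X - C μ)
  set u := v ᵥ* aeval A p
  have hmul : A *ᵥ u = μ • u := by
    rw [← Matrix.vecMul_transpose, hA.eq]
    exact vecMul_aeval_divByMonic_vecMul hq.vecMul_aeval hμ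
  have huu : u ⬝ᵥ u = 0 := by rw [vecMul_aeval_dotProduct hmul, heval, zero_mul]
  have hfactor : (X - C μ) * p = q := mul_divByMonic_eq_iff_isRoot.2 hμ
  have hp : p ≠ 0 := fun h => hq.monic.ne_zero (by rw [← hfactor, h, mul_zero])
  have hdegree := hq.natDegree_le p hp (dotProduct_self_eq_zero.1 huu)
  rw [← hfactor, natDegree_mul (X_sub_C_ne_zero μ) hp, natDegree_X_sub_C] at hdegree
  omega

omit [DecidableEq ι] in
lemma eq_zero_of_dotProduct_eq_zero [Field K] {κ : Type*} [Fintype κ] {b : κ → ι → K}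
    (hb : LinearIndependent K b) (hcard : Fintype.card κ = Fintype.card ι) {v : ι → K}
    (hv : ∀ j, v ⬝ᵥ b j = 0) : v = 0 := by
  have hspan := hb.span_eq_top_of_card_eq_finrank' (by simpa using hcard)
  have hzero : dotProductBilin K K v = 0 := LinearMap.ext_on hspan (by simpa [Set.EqOn] using hv)
  exact dotProduct_eq_zero v (LinearMap.congr_fun hzero)

lemma linearIndependent_fin_iff_polynomial [Field K] {E : Type*} [AddCommGroup E] [Module K E]
    (c : ℕ → E) (n : ℕ) :
    LinearIndependent K (fun s : Fin n => c s) ↔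
      ∀ p : K[X], p.natDegree < n → ∑ s ∈ range n, p.coeff s • c s = 0 → p = 0 := by
  rw [Fintype.linearIndependent_iff]
  refine ⟨fun h p hp hsum => ?_, fun h g hg => ?_⟩
  · rw [sum_range] at hsum
    ext s
    rcases lt_or_ge s n with hs | hs
    · exact h (fun s => p.coeff s) hsum ⟨s, hs⟩
    · exact coeff_eq_zero_of_natDegree_lt (hp.trans_le hs)
  · set p := (degreeLTEquiv K n).symm g
    have hcoeff (s : Fin n) : (p : K[X]).coeff s = g s :=
      congrFun ((degreeLTEquiv K n).apply_symm_apply g) s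
    have hp : (p : K[X]) = 0 := by
      by_contra hne
      refine hne (h p ((natDegree_lt_iff_degree_lt hne).2 (mem_degreeLT.1 p.2)) ?_)
      rw [sum_range]
      simpa only [hcoeff] using hg
    intro s
    rw [← hcoeff, hp, coeff_zero]

end MinimalAnnihilator

section AverageConsensus

variable {V : Type*} [Fintype V] {H : SimpleGraph V} {m : ℕ} {i : V}

section Module

variable {E : Type*} [AddCommGroup E] [Module ℝ E] {z : V → E}

lemma avgRound_of_reachable_const {N : V → ℕ} (hz : ∀ i j, H.Reachable i j → z i = z j) :
    avgRound H N z = z := by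
  ext i
  have hnbhd : ∑ j ∈ nbhd H i, nbrWeight N i • z j = ∑ _j ∈ nbhd H i, nbrWeight N i • z i :=
    sum_congr rfl fun j hj => by rw [hz i j (mem_nbhd.1 hj).reachable]
  rw [avgRound, hnbhd, ← sum_smul, ← add_smul, sub_add_cancel, one_smul]

lemma avgIter_of_reachable_const {N : V → ℕ} (hz : ∀ i j, H.Reachable i j → z i = z j) (t : ℕ) :
    avgIter H N z t = z :=
  Function.iterate_fixed (avgRound_of_reachable_const hz) t

end Module

section Matrix

variable [DecidableEq V] [DecidableRel H.Adj]

/-- The matrix of the linear iteration of average consensus on `H` with the common bound `m`. -/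
noncomputable def avgMatrix (H : SimpleGraph V) [DecidableRel H.Adj] (m : ℕ) : Matrix V V ℝ :=
  1 - (m : ℝ)⁻¹ • H.lapMatrix ℝ

lemma isSymm_avgMatrix : (avgMatrix H m).IsSymm :=
  Matrix.isSymm_one.sub ((H.isSymm_lapMatrix (R := ℝ)).smul _)

lemma avgMatrix_mulVec_eq_self_iff (hm : m ≠ 0) {f : V → ℝ} :
    avgMatrix H m *ᵥ f = f ↔ ∀ i j, H.Reachable i j → f i = f j := by
  have hm' : (m : ℝ)⁻¹ ≠ 0 := inv_ne_zero (Nat.cast_ne_zero.2 hm)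
  rw [avgMatrix, Matrix.sub_mulVec, Matrix.one_mulVec, Matrix.smul_mulVec, sub_eq_self,
    smul_eq_zero_iff_right hm', H.lapMatrix_mulVec_eq_zero_iff_forall_reachable]

lemma avgRound_eq_sum_avgMatrix {E : Type*} [AddCommGroup E] [Module ℝ E] (z : V → E) (i : V) :
    avgRound H (fun _ => m) z i = ∑ j, avgMatrix H m i j • z j := by
  have hentry (j : V) : avgMatrix H m i j = (if i = j then 1 - H.degree i * (m : ℝ)⁻¹ else 0) +
      if H.Adj i j then (m : ℝ)⁻¹ else 0 := by
    rcases eq_or_ne i j with rfl | hij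
    · simp [avgMatrix, SimpleGraph.lapMatrix, SimpleGraph.degMatrix, mul_comm]
    · simp [avgMatrix, SimpleGraph.lapMatrix, SimpleGraph.degMatrix, hij]
  have hnbhd : nbhd H i = H.neighborFinset i := by
    ext j
    rw [mem_nbhd, SimpleGraph.mem_neighborFinset]
  simp only [avgRound, nbrWeight, one_div, hnbhd, sum_const, nsmul_eq_mul,
    SimpleGraph.card_neighborFinset_eq_degree]
  simp only [hentry, add_smul, sum_add_distrib, ite_smul, zero_smul, sum_ite_eq, mem_univ, if_true,
    SimpleGraph.neighborFinset_eq_filter, sum_filter]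

lemma avgIter_eq_sum_avgMatrix_pow {E : Type*} [AddCommGroup E] [Module ℝ E] (z : V → E) (t : ℕ)
    (i : V) : avgIter H (fun _ => m) z t i = ∑ j, (avgMatrix H m ^ t) i j • z j := by
  induction t generalizing i with
  | zero => simp [avgIter, Matrix.one_apply]
  | succ t ih =>
    rw [avgIter, Function.iterate_succ_apply', ← avgIter, avgRound_eq_sum_avgMatrix]
    simp only [ih, pow_succ', Matrix.mul_apply, sum_smul, smul_sum, mul_smul]
    exact sum_comm

lemma sum_coeff_smul_avgIter {E : Type*} [AddCommGroup E] [Module ℝ E] {p : ℝ[X]} {n : ℕ}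
    (hp : p.natDegree < n) (z : V → E) (i : V) :
    ∑ s ∈ range n, p.coeff s • avgIter H (fun _ => m) z s i =
      ∑ j, (Pi.single i 1 ᵥ* aeval (avgMatrix H m) p) j • z j := by
  simp only [avgIter_eq_sum_avgMatrix_pow, Matrix.single_one_vecMul, Matrix.row_apply,
    aeval_eq_sum_range' hp, Matrix.sum_apply, Matrix.smul_apply, smul_sum, sum_smul, smul_assoc]
  exact sum_comm

end Matrix

section FiniteTime

variable {prep : ℕ → V → ℝ} (hm : Fintype.card V ≤ m)
  (hprep : LinearIndependent ℝ fun j : Fin (Fintype.card V) => prep j)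

include hm hprep

section Matrix

variable [DecidableEq V] [DecidableRel H.Adj]

lemma sum_coeff_smul_prepColumn_eq_zero_iff {p : ℝ[X]} {n : ℕ} (hp : p.natDegree < n) (i : V) :
    ∑ s ∈ range n, p.coeff s • prepColumn H (fun _ => m) prep i s = 0 ↔
      Pi.single i 1 ᵥ* aeval (avgMatrix H m) p = 0 := by
  have happly (j : Fin m) : (∑ s ∈ range n, p.coeff s • prepColumn H (fun _ => m) prep i s) j =
      (Pi.single i 1 ᵥ* aeval (avgMatrix H m) p) ⬝ᵥ prep j := by
    rw [Finset.sum_apply]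
    exact sum_coeff_smul_avgIter hp (prep j) i
  refine ⟨fun h => eq_zero_of_dotProduct_eq_zero hprep (Fintype.card_fin _) fun j => ?_,
    fun h => funext fun j => ?_⟩
  · exact (happly (j.castLE hm)).symm.trans (congrFun h _)
  · rw [happly, h, zero_dotProduct, Pi.zero_apply]

lemma not_linearIndependent_prepColumn_iff (i : V) (n : ℕ) :
    (¬ LinearIndependent ℝ fun s : Fin n => prepColumn H (fun _ => m) prep i s) ↔
      ∃ p : ℝ[X], p.natDegree < n ∧ p ≠ 0 ∧ Pi.single i 1 ᵥ* aeval (avgMatrix H m) p = 0 := by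
  rw [linearIndependent_fin_iff_polynomial]
  push Not
  refine exists_congr fun p => and_congr_right fun hp => ?_
  rw [sum_coeff_smul_prepColumn_eq_zero_iff hm hprep hp, and_comm]

lemma degIndex_lt_natDegree {p : ℝ[X]} (hp : p ≠ 0)
    (hzero : Pi.single i 1 ᵥ* aeval (avgMatrix H m) p = 0) :
    degIndex H (fun _ => m) prep i < p.natDegree := by
  have hdegree : p.natDegree ≠ 0 := by
    intro h
    rw [eq_C_of_natDegree_eq_zero h, aeval_C, Algebra.algebraMap_eq_smul_one, Matrix.vecMul_smul,
      Matrix.vecMul_one, smul_eq_zero_iff_left (by simp)] at hzero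
    exact hp (by rw [eq_C_of_natDegree_eq_zero h, hzero, C_0])
  have hle : degIndex H (fun _ => m) prep i ≤ p.natDegree - 1 :=
    Nat.sInf_le ((not_linearIndependent_prepColumn_iff hm hprep i _).2 ⟨p, by omega, hp, hzero⟩)
  omega

lemma exists_monic_vecMul_aeval_eq_zero (i : V) :
    ∃ q : ℝ[X], q.Monic ∧ q.natDegree = degIndex H (fun _ => m) prep i + 1 ∧
      Pi.single i 1 ᵥ* aeval (avgMatrix H m) q = 0 := by
  have hnonempty : {δ : ℕ | ¬ LinearIndependent ℝ fun s : Fin (δ + 2) =>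
      prepColumn H (fun _ => m) prep i s}.Nonempty :=
    ⟨m, fun h => by simpa using h.fintype_card_le_finrank⟩
  obtain ⟨p, hdegree, hp, hzero⟩ :=
    (not_linearIndependent_prepColumn_iff hm hprep i _).1 (Nat.sInf_mem hnonempty)
  have hlt := degIndex_lt_natDegree hm hprep hp hzero
  refine ⟨p * C p.leadingCoeff⁻¹, monic_mul_leadingCoeff_inv hp, ?_, ?_⟩
  · rw [natDegree_mul_leadingCoeff_inv _ hp]
    exact le_antisymm (Nat.lt_succ_iff.1 hdegree) hlt
  · rw [map_mul, ← Matrix.vecMul_vecMul, hzero, Matrix.zero_vecMul]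

lemma agentPoly_spec (i : V) :
    (agentPoly H (fun _ => m) prep i).Monic ∧
      (agentPoly H (fun _ => m) prep i).natDegree = degIndex H (fun _ => m) prep i + 1 ∧
      Pi.single i 1 ᵥ* aeval (avgMatrix H m) (agentPoly H (fun _ => m) prep i) = 0 := by
  have hsum_iff {q : ℝ[X]} (hq : q.natDegree = degIndex H (fun _ => m) prep i + 1) :=
    sum_coeff_smul_prepColumn_eq_zero_iff (H := H) hm hprep (hq.trans_lt (Nat.lt_succ_self _)) i
  have hexists : ∃ q : ℝ[X], q.Monic ∧ q.natDegree = degIndex H (fun _ => m) prep i + 1 ∧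
      ∑ s ∈ range (degIndex H (fun _ => m) prep i + 2),
        q.coeff s • prepColumn H (fun _ => m) prep i s = 0 := by
    obtain ⟨q, hmonic, hdegree, hzero⟩ := exists_monic_vecMul_aeval_eq_zero (H := H) hm hprep i
    exact ⟨q, hmonic, hdegree, (hsum_iff hdegree).2 hzero⟩
  obtain ⟨hmonic, hdegree, hsum⟩ := Classical.epsilon_spec hexists
  exact ⟨hmonic, hdegree, (hsum_iff hdegree).1 hsum⟩

lemma isMinimalAnnihilator_agentPoly (i : V) :
    IsMinimalAnnihilator (Pi.single i 1) (avgMatrix H m) (agentPoly H (fun _ => m) prep i) := by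
  obtain ⟨hmonic, hdegree, hzero⟩ := agentPoly_spec (H := H) hm hprep i
  exact ⟨hmonic, hzero, fun p hp h => hdegree.trans_le (degIndex_lt_natDegree hm hprep hp h)⟩

omit [DecidableEq V] [DecidableRel H.Adj] in
lemma isRoot_one_agentPoly (i : V) : (agentPoly H (fun _ => m) prep i).IsRoot 1 := by
  have hm0 : m ≠ 0 := ((Fintype.card_pos_iff.2 ⟨i⟩).trans_le hm).ne'
  classical
  have hone : avgMatrix H m *ᵥ 1 = (1 : ℝ) • (1 : V → ℝ) := by
    rw [one_smul, avgMatrix_mulVec_eq_self_iff hm0]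
    exact fun _ _ _ => rfl
  exact isRoot_of_vecMul_aeval_eq_zero (agentPoly_spec hm hprep i).2.2 hone (by simp)

lemma vecMul_aeval_agentQuot_of_reachable {j l : V} (hjl : H.Reachable j l) :
    (Pi.single i 1 ᵥ* aeval (avgMatrix H m) (agentQuot H (fun _ => m) prep i)) j =
      (Pi.single i 1 ᵥ* aeval (avgMatrix H m) (agentQuot H (fun _ => m) prep i)) l := by
  have hm0 : m ≠ 0 := ((Fintype.card_pos_iff.2 ⟨i⟩).trans_le hm).ne'
  have hfixed := vecMul_aeval_divByMonic_vecMul (agentPoly_spec (H := H) hm hprep i).2.2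
    (isRoot_one_agentPoly hm hprep i)
  rw [one_smul, ← Matrix.mulVec_transpose, isSymm_avgMatrix.eq] at hfixed
  exact (avgMatrix_mulVec_eq_self_iff hm0).1 hfixed j l hjl

end Matrix

lemma natDegree_agentQuot (i : V) :
    (agentQuot H (fun _ => m) prep i).natDegree = degIndex H (fun _ => m) prep i := by
  classical
  rw [agentQuot, natDegree_divByMonic _ (monic_X_sub_C _), (agentPoly_spec hm hprep i).2.1,
    natDegree_X_sub_C, Nat.add_sub_cancel]

lemma eval_one_agentQuot_ne_zero (i : V) : (agentQuot H (fun _ => m) prep i).eval 1 ≠ 0 := by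
  classical
  exact (isMinimalAnnihilator_agentPoly hm hprep i).eval_divByMonic_ne_zero isSymm_avgMatrix
    (isRoot_one_agentPoly hm hprep i)

variable {E : Type*} [AddCommGroup E] [Module ℝ E]

lemma ftaConsensus_of_reachable_const {z : V → E} (hz : ∀ i j, H.Reachable i j → z i = z j)
    (i : V) : ftaConsensus H (fun _ => m) prep z i = z i := by
  rw [ftaConsensus]
  simp only [avgIter_of_reachable_const hz, ← sum_smul, ← sum_div]
  rw [← natDegree_agentQuot hm hprep]
  have heval := eval_eq_sum_range (p := agentQuot H (fun _ => m) prep i) 1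
  simp only [one_pow, mul_one] at heval
  rw [← heval, div_self (eval_one_agentQuot_ne_zero hm hprep i), one_smul]

lemma ftaConsensus_componentMean (z : V → E) (i : V) :
    ftaConsensus H (fun _ => m) prep (componentMean H z) i =
      ftaConsensus H (fun _ => m) prep z i := by
  classical
  set p := agentQuot H (fun _ => m) prep i with hp
  have hsum (y : V → E) : ftaConsensus H (fun _ => m) prep y i =
      (p.eval 1)⁻¹ • ∑ j, (Pi.single i 1 ᵥ* aeval (avgMatrix H m) p) j • y j := by
    rw [← sum_coeff_smul_avgIter (Nat.lt_succ_of_le (natDegree_agentQuot hm hprep i).le), smul_sum]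
    simp only [ftaConsensus, ← hp, div_eq_inv_mul, mul_smul]
  rw [hsum, hsum,
    sum_smul_componentMean fun j l => vecMul_aeval_agentQuot_of_reachable hm hprep]

theorem ftaConsensus_eq_componentMean (z : V → E) (i : V) :
    ftaConsensus H (fun _ => m) prep z i = componentMean H z i := by
  rw [← ftaConsensus_componentMean hm hprep, ftaConsensus_of_reachable_const hm hprep]
  exact fun j l hjl => componentMean_eq_of_reachable hjl z

end FiniteTime

end AverageConsensus

lemma eq_of_reachable_clusterGraph {V : Type*} {k : ℕ} {G : SimpleGraph V} {a : V → Fin k}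
    {i j : V} (h : (clusterGraph G a).Reachable i j) : a i = a j := by
  obtain ⟨p⟩ := h
  induction p with
  | nil => rfl
  | cons hadj _ ih => exact hadj.2.trans ih

section NearestCentroid

variable {d k : ℕ} {y : EuclideanSpace ℝ (Fin d)}

lemma ofExt_toExt (v : EuclideanSpace ℝ (Fin d)) : ofExt (toExt v) = v := by
  ext l
  simp [ofExt, toExt]

lemma extDist_optToExt_none (hd : 1 ≤ d) (y : EuclideanSpace ℝ (Fin d)) :
    extDist (optToExt none) y = ⊤ :=
  if_neg fun h => (h ⟨0, hd⟩).1 rfl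

lemma extDist_optToExt_some (v y : EuclideanSpace ℝ (Fin d)) :
    extDist (optToExt (some v)) y = ((‖y - v‖ : ℝ) : EReal) := by
  rw [extDist, if_pos fun l => ⟨EReal.coe_ne_bot _, EReal.coe_ne_top _⟩, norm_sub_rev, optToExt,
    ofExt_toExt]

lemma extDist_le_iff_sqDist_le (hd : 1 ≤ d) {c c' : Option (EuclideanSpace ℝ (Fin d))} :
    extDist (optToExt c) y ≤ extDist (optToExt c') y ↔ sqDist y c ≤ sqDist y c' := by
  rcases c' with _ | v'
  · simp only [extDist_optToExt_none hd, sqDist, le_top]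
  rcases c with _ | v
  · simp only [extDist_optToExt_none hd, extDist_optToExt_some, sqDist, top_le_iff,
      EReal.coe_ne_top]
  · simp only [extDist_optToExt_some, sqDist, EReal.coe_le_coe_iff]
    exact (sq_le_sq₀ (norm_nonneg _) (norm_nonneg _)).symm

lemma argminSet_extDist (hd : 1 ≤ d) (c : Fin k → Option (EuclideanSpace ℝ (Fin d))) :
    (argminSet fun j => extDist (optToExt (c j)) y) = argminSet fun j => sqDist y (c j) := by
  simp only [argminSet, extDist_le_iff_sqDist_le hd]

lemma argminSet_nonempty [Nonempty (Fin k)] (f : Fin k → EReal) : (argminSet f).Nonempty := by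
  obtain ⟨j, hj⟩ := Finite.exists_min f
  exact ⟨j, by simpa [argminSet] using hj⟩

lemma ne_none_of_mem_argminSet {c : Fin k → Option (EuclideanSpace ℝ (Fin d))} {a j : Fin k}
    (ha : a ∈ argminSet fun j => sqDist y (c j)) (hj : c j ≠ none) : c a ≠ none := by
  obtain ⟨v, hv⟩ := Option.ne_none_iff_exists'.1 hj
  have hle : sqDist y (c a) ≤ sqDist y (c j) := (mem_filter.1 ha).2 j
  intro hnone
  rw [hnone, hv] at hle
  exact EReal.coe_ne_top _ (top_le_iff.1 hle)

lemma propInit_apply (a j : Fin k) (c : Fin d → EReal) :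
    propInit a c j = if j = a then c else ⊥ := by
  ext l
  by_cases h : j = a <;> simp [propInit, mu, muHat, h]

lemma toReal_sqDist {c : Option (EuclideanSpace ℝ (Fin d))} (hc : c ≠ none) :
    (sqDist y c).toReal = ‖y - ofExt (optToExt c)‖ ^ 2 := by
  obtain ⟨v, rfl⟩ := Option.ne_none_iff_exists'.1 hc
  rw [sqDist, EReal.toReal_coe, optToExt, ofExt_toExt]

end NearestCentroid

section Refine

variable {V : Type*} [Fintype V] {d k : ℕ} {x : V → EuclideanSpace ℝ (Fin d)} {a : V → Fin k}
  {c : Fin k → Option (EuclideanSpace ℝ (Fin d))}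

lemma single_apply_eq_r_smul {E : Type*} [AddCommGroup E] [Module ℝ E] (b j : Fin k) (w : E) :
    (Pi.single b w : Fin k → E) j = r b j • w := by
  simp only [Pi.single_apply, r, ite_smul, one_smul, zero_smul, eq_comm]

lemma sum_r_ne_zero_iff {j : Fin k} : ∑ i, r (a i) j ≠ 0 ↔ ∃ i, a i = j := by
  rw [Ne, sum_eq_zero_iff_of_nonneg fun i _ => by unfold r; split_ifs <;> norm_num]
  simp [r]

lemma refine_ne_none_iff {j : Fin k} : refine x a j ≠ none ↔ ∃ i, a i = j := by
  rw [← sum_r_ne_zero_iff, refine]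
  split_ifs with h <;> simp [h]

lemma objective_eq (hc : ∀ i, c (a i) ≠ none) :
    objective x c a = ∑ i, ‖x i - ofExt (optToExt (c (a i)))‖ ^ 2 := by
  simp only [objective, r, ite_mul, one_mul, zero_mul, sum_ite_eq, mem_univ, if_true,
    toReal_sqDist (hc _)]

lemma dObjective_eq (hc : ∀ i, c (a i) ≠ none) :
    dObjective x (fun _ j => optToExt (c j)) (fun i => some (a i)) = objective x c a := by
  simp only [objective_eq hc, dObjective, Option.some.injEq, ite_mul, one_mul, zero_mul,
    sum_ite_eq, mem_univ, if_true]

lemma extQuot_smul {t : ℝ} (ht : t ≠ 0) (p : EuclideanSpace ℝ (Fin d) × ℝ) :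
    extQuot (t • p) = extQuot p := by
  simp only [extQuot, Prod.smul_fst, Prod.smul_snd, smul_eq_mul, mul_eq_zero, ht, false_or,
    mul_inv_rev, mul_smul, inv_smul_smul₀ ht]

lemma extQuot_sum_r (x : V → EuclideanSpace ℝ (Fin d)) (a : V → Fin k) (j : Fin k) :
    extQuot (∑ l, r (a l) j • (x l, (1 : ℝ))) = optToExt (refine x a j) := by
  have hpair : ∑ l, r (a l) j • (x l, (1 : ℝ)) = (∑ l, r (a l) j • x l, ∑ l, r (a l) j) := by
    simp only [Prod.ext_iff, Prod.fst_sum, Prod.snd_sum, Prod.smul_fst, Prod.smul_snd,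
      smul_eq_mul, mul_one, and_self]
  rw [hpair, extQuot, refine]
  split_ifs <;> rfl

end Refine

lemma stopStep_pos (M : ℕ) (e : ℕ → Prop) : 1 ≤ stopStep M e :=
  (Nat.sInf_mem (s := {T : ℕ | 1 ≤ T ∧ (M ≤ T ∨ e T)})
    ⟨max 1 M, le_max_left 1 M, Or.inl (le_max_right 1 M)⟩).1

lemma stopStep_congr {M : ℕ} {e e' : ℕ → Prop} (h : ∀ T, e (T + 1) ↔ e' (T + 1)) :
    stopStep M e = stopStep M e' := by
  refine congrArg sInf (Set.ext fun T => and_congr_right fun hT => ?_)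
  obtain ⟨S, rfl⟩ := Nat.exists_eq_add_of_le' hT
  rw [h S]

namespace Data

variable {V : Type*} [Fintype V] {d k : ℕ}

lemma kCentroid_kAssign_ne_none (P : Data V d k)
    (htie : ∀ (T : ℕ) (i : V) (s : Finset (Fin k)), s.Nonempty → P.tie T i s ∈ s) (T : ℕ) (i : V) :
    P.kCentroid T (P.kAssign T i) ≠ none := by
  have : Nonempty (Fin k) := ⟨P.kAssign T i⟩
  have hexists : ∃ j, P.kCentroid T j ≠ none := by
    cases T with
    | zero => exact ⟨P.kAssign 0 i, Option.some_ne_none _⟩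
    | succ T => exact ⟨P.kAssign T i, refine_ne_none_iff.2 ⟨i, rfl⟩⟩
  obtain ⟨j, hj⟩ := hexists
  exact ne_none_of_mem_argminSet (htie T i _ (argminSet_nonempty _)) hj

/-- The assumptions under which the consensus procedures of a run are correct: a connected network
with distinct identifiers, a valid bound on its size, and in each execution of average consensus
linearly independent initial conditions of the first `card V` preparatory runs. -/
structure WellPosed (P : Data V d k) : Prop where
  connected : P.graph.Connected
  uid_injective : Function.Injective P.uid
  card_le : Fintype.card V ≤ P.nBound
  prep_independent : ∀ call : FTACall,
    LinearIndependent ℝ fun j : Fin (Fintype.card V) => P.prep call j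

namespace WellPosed

variable {P : Data V d k} (hP : P.WellPosed)

include hP

lemma isTransversal_isLeader : IsTransversal P.graph P.isLeader :=
  isTransversal_leader hP.uid_injective fun _ => hP.card_le

lemma card_ne_zero : (Fintype.card V : ℝ) ≠ 0 :=
  have := hP.connected.nonempty
  Nat.cast_ne_zero.2 Fintype.card_ne_zero

lemma size_eq (i : V) : P.size i = Fintype.card V := by
  classical
  rw [size, ftaConsensus_eq_componentMean hP.card_le (hP.prep_independent _),
    hP.isTransversal_isLeader.componentMean_indicator,
    component_eq_univ hP.connected.preconnected, card_univ, one_div, inv_inv]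

lemma sizeNat_eq : P.sizeNat = fun _ => Fintype.card V := by
  ext i
  rw [sizeNat, hP.size_eq, Nat.floor_natCast]

lemma card_le_sizeNat (i : V) : Fintype.card V ≤ P.sizeNat i := by
  rw [hP.sizeNat_eq]

lemma ftaConsensus_sizeNat {E : Type*} [AddCommGroup E] [Module ℝ E] (H : SimpleGraph V)
    (call : FTACall) (z : V → E) (i : V) :
    ftaConsensus H P.sizeNat (P.prep call) z i = componentMean H z i := by
  rw [hP.sizeNat_eq, ftaConsensus_eq_componentMean le_rfl (hP.prep_independent _)]

lemma ftaConsensus_graph {E : Type*} [AddCommGroup E] [Module ℝ E] (call : FTACall) (z : V → E)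
    (i : V) :
    ftaConsensus P.graph P.sizeNat (P.prep call) z i = (Fintype.card V : ℝ)⁻¹ • ∑ j, z j := by
  rw [hP.ftaConsensus_sizeNat, componentMean_of_preconnected hP.connected.preconnected]

lemma dReceived_dInit : P.dReceived P.dInit = fun _ j => optToExt (some (P.cInit j)) := by
  ext1 i
  refine maxConsensus_eq_of_attained hP.connected.preconnected (hP.card_le_sizeNat i)
    (fun m j => ?_) fun j => Or.inr ?_
  · by_cases hm : P.isLeader m
    · simp only [dInit, hm, if_true, optToExt, le_rfl]
    · simp only [dInit, hm, if_false]
      exact bot_le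
  · obtain ⟨l, ⟨-, hl⟩, -⟩ := hP.isTransversal_isLeader i
    exact ⟨l, by simp only [dInit, hl, if_true, optToExt]⟩

lemma dReceived_of_refine {s : DState V d k} {a : V → Fin k}
    (ha : s.choice = fun i => some (a i))
    (hc : s.centroid = fun _ j => optToExt (refine P.x a j)) :
    P.dReceived s = fun _ j => optToExt (refine P.x a j) := by
  ext1 i
  refine maxConsensus_eq_of_attained hP.connected.preconnected (hP.card_le_sizeNat i)
    (fun m j => ?_) fun j => ?_
  · simp only [ha, hc, propInit_apply]
    split_ifs with h
    · rw [h]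
    · exact bot_le
  · by_cases hj : ∃ m, a m = j
    · obtain ⟨m, rfl⟩ := hj
      exact Or.inr ⟨m, by simp only [ha, hc, propInit_apply, if_true]⟩
    · rw [not_not.1 (mt refine_ne_none_iff.1 hj)]
      exact Or.inl rfl

lemma isTransversal_isSubLeader (a : V → Fin k) :
    IsTransversal (clusterGraph P.graph a) (P.isSubLeader a) :=
  isTransversal_leader hP.uid_injective hP.card_le_sizeNat

lemma scc_eq (T : ℕ) (a : V → Fin k) (i : V) :
    P.scc T a i = componentMean (clusterGraph P.graph a) P.x i :=
  hP.ftaConsensus_sizeNat _ _ _ i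

lemma scs_eq (T : ℕ) (a : V → Fin k) (i : V) :
    P.scs T a i = #(component (clusterGraph P.graph a) i) := by
  classical
  rw [scs, hP.ftaConsensus_sizeNat, (hP.isTransversal_isSubLeader a).componentMean_indicator,
    one_div, inv_inv]

open Classical in
lemma etaInit_apply (T : ℕ) (a : V → Fin k) (i : V) (j : Fin k) :
    P.etaInit T a i j = if P.isSubLeader a i then
      ∑ l ∈ component (clusterGraph P.graph a) i, r (a l) j • (P.x l, (1 : ℝ)) else 0 := by
  have htotal : (P.scs T a i • P.scc T a i, P.scs T a i) =
      ∑ l ∈ component (clusterGraph P.graph a) i, (P.x l, (1 : ℝ)) := by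
    rw [hP.scs_eq, hP.scc_eq, card_smul_componentMean]
    simp [Prod.ext_iff, Prod.fst_sum, Prod.snd_sum]
  rw [etaInit, single_apply_eq_r_smul, htotal, smul_ite, smul_sum, Prod.mk_zero_zero, smul_zero]
  refine if_congr Iff.rfl (sum_congr rfl fun l hl => ?_) rfl
  rw [eq_of_reachable_clusterGraph (mem_component.1 hl)]

lemma sum_etaInit_apply (T : ℕ) (a : V → Fin k) (j : Fin k) :
    (∑ i, P.etaInit T a i) j = ∑ l, r (a l) j • (P.x l, (1 : ℝ)) := by
  classical
  simp only [Finset.sum_apply, hP.etaInit_apply, (hP.isTransversal_isSubLeader a).sum_sum_component]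

lemma dCentroid_eq (T : ℕ) (a : V → Fin k) :
    P.dCentroid T a = fun _ j => optToExt (refine P.x a j) := by
  ext1 i
  ext1 j
  rw [dCentroid, hP.ftaConsensus_graph, Pi.smul_apply, hP.sum_etaInit_apply,
    extQuot_smul (inv_ne_zero hP.card_ne_zero), extQuot_sum_r]

lemma dNu_assignments_eq_zero_iff (hrule : P.rule = .assignments) (T : ℕ)
    (a' : V → Option (Fin k)) (a : V → Fin k) (c : V → Fin k → Fin d → EReal) (i : V) :
    P.dNu T a' a c i = 0 ↔ a' = fun m => some (a m) := by
  classical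
  rw [dNu, hrule, funext_iff]
  exact maxConsensus_indicator_eq_zero_iff hP.connected.preconnected (hP.card_le_sizeNat i)

lemma dNu_objective (hrule : P.rule ≠ .assignments) (T : ℕ) (a' : V → Option (Fin k))
    (a : V → Fin k) (i : V) :
    P.dNu T a' a (fun _ j => optToExt (refine P.x a j)) i = objective P.x (refine P.x a) a := by
  have hfta : P.dNu T a' a (fun _ j => optToExt (refine P.x a j)) i =
      ftaConsensus P.graph P.sizeNat (P.prep (.exitValue T))
        (fun j => P.size j * ‖ofExt (optToExt (refine P.x a (a j))) - P.x j‖ ^ 2) i := by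
    unfold dNu
    split
    · exact absurd ‹_› hrule
    · rfl
  rw [hfta, hP.ftaConsensus_graph, objective_eq fun m => refine_ne_none_iff.2 ⟨m, rfl⟩]
  simp only [hP.size_eq, ← mul_sum, smul_eq_mul, inv_mul_cancel_left₀ hP.card_ne_zero,
    norm_sub_rev (P.x _)]

end WellPosed

variable {P : Data V d k}

omit [Fintype V] in
lemma dChoice_optToExt (hd : 1 ≤ d) (T : ℕ) (c : Fin k → Option (EuclideanSpace ℝ (Fin d))) :
    P.dChoice T (fun _ j => optToExt (c j)) = P.assign T c := by
  ext1 i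
  rw [dChoice, argminSet_extDist hd, assign]

section Step

variable {s : DState V d k} {T : ℕ} (hd : 1 ≤ d)
  (hs : P.dReceived s = fun _ j => optToExt (P.kCentroid T j))

include hd hs

lemma dChoice_dReceived : P.dChoice T (P.dReceived s) = P.kAssign T := by
  rw [hs, dChoice_optToExt hd, kAssign]

lemma choice_dStep : (P.dStep T s).choice = fun i => some (P.kAssign T i) := by
  rw [← dChoice_dReceived hd hs]
  rfl

lemma mem_cnbhd_dStep {i l : V} :
    l ∈ (P.dStep T s).cnbhd i ↔ P.graph.Adj i l ∧ P.kAssign T l = P.kAssign T i := by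
  simp only [dStep, dChoice_dReceived hd hs, mem_filter, mem_nbhd]

lemma centroid_dStep (hP : P.WellPosed) :
    (P.dStep T s).centroid = fun _ j => optToExt (P.kCentroid (T + 1) j) := by
  simp only [dStep, dChoice_dReceived hd hs, hP.dCentroid_eq, kCentroid, kAssign]

lemma exit_dStep_assignments (hP : P.WellPosed) (hrule : P.rule = .assignments) (i : V) :
    (P.dStep T s).exit i ↔ s.choice = fun m => some (P.kAssign T m) := by
  rw [← hP.dNu_assignments_eq_zero_iff hrule (T + 1) _ _ (P.dCentroid (T + 1) (P.kAssign T)) i]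
  simp only [dStep, dChoice_dReceived hd hs, dExit, hrule]

lemma nu_dStep (hP : P.WellPosed) (hrule : P.rule ≠ .assignments) (i : V) :
    (P.dStep T s).nu i = some (P.kObjective T) := by
  simp only [dStep, dChoice_dReceived hd hs, hP.dCentroid_eq, hP.dNu_objective hrule]
  rfl

lemma exit_dStep_objective (hP : P.WellPosed) (hrule : P.rule ≠ .assignments) (i : V) :
    (P.dStep T s).exit i ↔ P.dExit (s.nu i) (P.kObjective T) := by
  simp only [dStep, dChoice_dReceived hd hs, hP.dCentroid_eq, hP.dNu_objective hrule]
  rfl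

end Step

omit [Fintype V] in
lemma not_dExit_none (hrule : P.rule ≠ .assignments) (ν : ℝ) : ¬ P.dExit none ν := by
  unfold dExit
  split <;> simp_all

lemma dExit_kObjective_iff (hrule : P.rule ≠ .assignments) (T : ℕ) :
    P.dExit (some (P.kObjective T)) (P.kObjective (T + 1)) ↔ P.kExit (T + 2) := by
  unfold dExit kExit
  cases hcase : P.rule <;> simp_all

lemma kExit_assignments_iff (hrule : P.rule = .assignments) (T : ℕ) :
    P.kExit (T + 2) ↔ P.kAssign (T + 1) = P.kAssign T := by
  rw [kExit, hrule]

namespace WellPosed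

variable (hP : P.WellPosed) (hd : 1 ≤ d)

include hP hd

theorem dReceived_dState (T : ℕ) :
    P.dReceived (P.dState T) = fun _ j => optToExt (P.kCentroid T j) := by
  induction T with
  | zero => exact hP.dReceived_dInit
  | succ T ih => exact hP.dReceived_of_refine (choice_dStep hd ih) (centroid_dStep hd ih hP)

theorem dState_succ (T : ℕ) :
    (P.dState (T + 1)).received = (fun _ j => optToExt (P.kCentroid T j)) ∧
    (P.dState (T + 1)).choice = (fun i => some (P.kAssign T i)) ∧
    (P.dState (T + 1)).centroid = (fun _ j => optToExt (P.kCentroid (T + 1) j)) :=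
  have hreceived := hP.dReceived_dState hd T
  ⟨hreceived, choice_dStep hd hreceived, centroid_dStep hd hreceived hP⟩

theorem exit_dState_succ_iff (T : ℕ) (i : V) :
    (P.dState (T + 1)).exit i ↔ P.kExit (T + 1) := by
  have hreceived := hP.dReceived_dState hd
  by_cases hrule : P.rule = .assignments
  · refine (exit_dStep_assignments hd (hreceived T) hP hrule i).trans ?_
    cases T with
    | zero => exact iff_of_false (fun h => Option.some_ne_none _ (congrFun h i).symm) id
    | succ T =>
      rw [kExit_assignments_iff hrule, (hP.dState_succ hd T).2.1]
      simp only [funext_iff, Option.some.injEq, eq_comm]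
  · refine (exit_dStep_objective hd (hreceived T) hP hrule i).trans ?_
    cases T with
    | zero => exact iff_of_false (not_dExit_none hrule _) id
    | succ T =>
      rw [← dExit_kObjective_iff hrule, dState, nu_dStep hd (hreceived T) hP hrule]

theorem dStop_eq_kStop (i : V) : P.dStop i = P.kStop :=
  stopStep_congr fun T => hP.exit_dState_succ_iff hd T i

end WellPosed

end Data

end DistKMeans

theorem theorem1 {V : Type*} [Fintype V] {d k : ℕ} (hd : 1 ≤ d) (hk : 1 ≤ k)
    (P : DistKMeans.Data V d k)
    (hG : P.graph.Connected)
    (huid : Function.Injective P.uid)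
    (hn : Fintype.card V ≤ P.nBound)
    (hprep : ∀ call : DistKMeans.FTACall,
      LinearIndependent ℝ (fun j : Fin (Fintype.card V) => P.prep call j))
    (htie : ∀ (T : ℕ) (i : V) (s : Finset (Fin k)), s.Nonempty → P.tie T i s ∈ s)
    (hM : 1 ≤ P.M) :
    (∀ T : ℕ,
      (∀ i j, (P.dState (T + 1)).received i j = DistKMeans.optToExt (P.kCentroid T j)) ∧
      (∀ i, (P.dState (T + 1)).choice i = some (P.kAssign T i)) ∧
      (∀ i j, (P.dState (T + 1)).centroid i j = DistKMeans.optToExt (P.kCentroid (T + 1) j)) ∧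
      DistKMeans.dObjective P.x (P.dState (T + 1)).received (P.dState (T + 1)).choice =
        DistKMeans.objective P.x (P.kCentroid T) (P.kAssign T) ∧
      DistKMeans.dObjective P.x (P.dState (T + 1)).centroid (P.dState (T + 1)).choice =
        DistKMeans.objective P.x (P.kCentroid (T + 1)) (P.kAssign T) ∧
      (∀ i, (P.dState (T + 1)).exit i ↔ P.kExit (T + 1))) ∧
    (∀ i, P.dStop i = P.kStop ∧
      (∀ j, (P.dState (P.dStop i)).centroid i j = DistKMeans.optToExt (P.kCentroid P.kStop j)) ∧
      (P.dState (P.dStop i)).choice i = some (P.kAssign (P.kStop - 1) i) ∧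
      (∀ l, l ∈ (P.dState (P.dStop i)).cnbhd i ↔
        P.graph.Adj i l ∧ P.kAssign (P.kStop - 1) l = P.kAssign (P.kStop - 1) i)) := by
  have hP : P.WellPosed := ⟨hG, huid, hn, hprep⟩
  refine ⟨fun T => ?_, fun i => ?_⟩
  · obtain ⟨hreceived, hchoice, hcentroid⟩ := hP.dState_succ hd T
    simp only [hreceived, hchoice, hcentroid, implies_true, true_and]
    exact ⟨DistKMeans.dObjective_eq (P.kCentroid_kAssign_ne_none htie T),
      DistKMeans.dObjective_eq fun i => DistKMeans.refine_ne_none_iff.2 ⟨i, rfl⟩,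
      hP.exit_dState_succ_iff hd T⟩
  · obtain ⟨S, hS⟩ : ∃ S, P.kStop = S + 1 :=
      Nat.exists_eq_add_of_le' (DistKMeans.stopStep_pos P.M P.kExit)
    obtain ⟨-, hchoice, hcentroid⟩ := hP.dState_succ hd S
    rw [hP.dStop_eq_kStop hd i, hS, Nat.add_sub_cancel, hchoice, hcentroid]
    exact ⟨rfl, fun _ => rfl, rfl,
      fun _ => DistKMeans.Data.mem_cnbhd_dStep hd (hP.dReceived_dState hd S)⟩
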